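/- Let $G=(C,S,E)$ be a bipartite graph with candidates $C=\{c_1,\dots,c_n\}$, positions $S=\{s_1,\dots,s_\ell\}$ and at least one matching of cardinality $\ell$; let $\mathcal M$ be the set of its maximum matchings, and write $s(e)$ for the position of an edge $e\in E$. A problem instance is a matrix $P=(p_{e,e'})\in[0,1]^{E\times E}$ with $p_{e,e'}+p_{e',e}=1$ if $s(e)=s(e')$ (so $p_{e,e}=\frac12$) and $p_{e,e'}=0$ otherwise. For $M_1,M_2\in\mathcal M$ put $f(M_1,M_2,P)=\frac1\ell\,\chi_{M_1}^{T}P\,\chi_{M_2}$, where $\chi_M\in\{0,1\}^E$ is the indicator vector of $M$. The Condorcet winner of $P$, if it exists, is the $M^C_*\in\mathcal M$ with $f(M^C_*,M,P)>\frac12$ for all $M\in\mathcal M\setminus\{M^C_*\}$. For $e\notin M^C_*$ let $\Delta^C_e=\frac12-\max_{M\in\mathcal M,\,e\in M}f(M,M^C_*,P)$ (with $\max\emptyset=-\infty$ and $\frac{1}{\infty}=0$, so that edges in no maximum matching contribute $0$ below). For $M\in\mathcal M\setminus\{M^C_*\}$ let $\mathcal O(M)=\{M_x\in\mathcal M\setminus\{M\}: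 f(M_x,M,P)\ge\frac12\}$. An algorithm knows $G$ but not $P$. In each round it either samples a pair $(e,e')$ with $s(e)=s(e')$, observing an independent Bernoulli variable with mean $p_{e,e'}$, or stops and outputs a set of edges; its choices may be randomized and may depend on all earlier samples and outcomes. It is $\delta$-correct if, for every instance $P$ that has a Condorcet winner, it stops and outputs this winner with probability at least $1-\delta$. Theorem. There is a universal constant $c>0$ such that the following holds. Let $G$ be as above and let $P$ be an instance with Condorcet winner $M^C_*$ such that, for every $M\in\mathcal M\setminus\{M^C_*\}$ and every $M_x\in\mathcal O(M)$, $f(M,M^C_*,P)\le f(M,M_x,P)$ and $M^C_*\setminus M\subseteq M_x\setminus M$. Suppose that, for some $\gamma$ with $0<\gamma<\frac{1}{2(2+\ell)}$, $\frac12-\gamma\le p_{e,e'}\le\frac12+\gamma$ for all $e,e'\in E$ with $s(e)=s(e')$. Then, for every $\delta\in(0,0.1)$, the expected number of samples that any $\delta$-correct algorithm draws on the instance $P$ is at least $$c\sum_{e\in E\setminus M^C_*}\frac{1}{\ell^2(\Delta^C_e)^2}\ln\Big(\frac1\delta\Big).$$ -/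

import Mathlib

open scoped ENNReal

noncomputable section

namespace CPEDB

variable {n ℓ : ℕ}

/-- The bipartite graph with candidates `Fin n` and positions `Fin ℓ` is given by its edge set
`E`; the arms are the elements of `E`. The edge `e = (c, s_j)` has candidate `c` and position
index `j`. -/
def cand {E : Finset (Fin n × Fin ℓ)} (e : E) : Fin n := e.1.1

/-- The position index `s(e)` of an edge. -/
def pos {E : Finset (Fin n × Fin ℓ)} (e : E) : Fin ℓ := e.1.2

/-- A set of edges is a matching if no two distinct edges of it share an endpoint. -/
def IsMatching {E : Finset (Fin n × Fin ℓ)} (M : Finset E) : Prop :=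
  ∀ e ∈ M, ∀ e' ∈ M, e ≠ e' → cand e ≠ cand e' ∧ pos e ≠ pos e'

/-- The decision class: all maximum matchings of the graph. -/
def decisionClass (E : Finset (Fin n × Fin ℓ)) : Set (Finset E) :=
  {M | IsMatching M ∧ ∀ N : Finset E, IsMatching N → N.card ≤ M.card}

/-- A preference matrix on the edges: `prob e e'` is the probability that `e` wins against `e'`
if the two edges are comparable (same position), and `0` otherwise. Note that
`prob e e' + prob e' e = 1` gives `prob e e = 1 / 2`. -/
structure Preference (E : Finset (Fin n × Fin ℓ)) where
  /-- the entries of the matrix -/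
  prob : E → E → ℝ
  nonneg : ∀ e e', 0 ≤ prob e e'
  le_one : ∀ e e', prob e e' ≤ 1
  add_swap : ∀ e e', pos e = pos e' → prob e e' + prob e' e = 1
  incomparable : ∀ e e', pos e ≠ pos e' → prob e e' = 0

/-- The preference probability `f(M₁, M₂, P) = (1/ℓ) χ_{M₁}ᵀ P χ_{M₂}` of `M₁` over `M₂`. As
entries of incomparable pairs vanish, for matchings covering all positions this is the average
over the positions `j` of the probability that the edge of `M₁` at `j` wins against the edge of
`M₂` at `j`. -/
def Preference.f {E : Finset (Fin n × Fin ℓ)} (P : Preference E) (M₁ M₂ : Finset E) : ℝ :=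
  (1 / (ℓ : ℝ)) * ∑ e ∈ M₁, ∑ e' ∈ M₂, P.prob e e'

/-- `M` is the Condorcet winner: a matching of the decision class that wins against every other
one with probability strictly better than `1 / 2`. -/
def Preference.IsCondorcetWinner {E : Finset (Fin n × Fin ℓ)} (P : Preference E)
    (M : Finset E) : Prop :=
  M ∈ decisionClass E ∧ ∀ N ∈ decisionClass E, N ≠ M → 1 / 2 < P.f M N

/-- The set `O(M)` of the matchings of the decision class, other than `M`, that beat `M`. -/
def Preference.beaters {E : Finset (Fin n × Fin ℓ)} (P : Preference E) (M : Finset E) :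
    Set (Finset E) :=
  {N | N ∈ decisionClass E ∧ N ≠ M ∧ 1 / 2 ≤ P.f N M}

open Classical in
/-- The Condorcet gap of an edge with respect to the Condorcet winner `Mstar`. The maximum over
an empty family of matchings is `-∞`, so that the gap is then `+∞`. -/
def Preference.gap {E : Finset (Fin n × Fin ℓ)} (P : Preference E) (Mstar : Finset E) (e : E) :
    EReal :=
  if e ∈ Mstar then
    ((1 / 2 : ℝ) : EReal) - ⨆ M ∈ {M ∈ decisionClass E | e ∉ M}, (P.f M Mstar : EReal)
  else
    ((1 / 2 : ℝ) : EReal) - ⨆ M ∈ {M ∈ decisionClass E | e ∈ M}, (P.f M Mstar : EReal)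

/-- A duel: a pair of comparable edges. -/
def Duel (E : Finset (Fin n × Fin ℓ)) : Type :=
  {d : E × E // pos d.1 = pos d.2}

/-- The observation of a duel `(e, e')`: `true` (`e` wins) with probability `prob e e'`. -/
def Preference.observe {E : Finset (Fin n × Fin ℓ)} (P : Preference E) (d : Duel E) : PMF Bool :=
  PMF.ofFintype
    (fun b => if b then ENNReal.ofReal (P.prob d.1.1 d.1.2)
      else ENNReal.ofReal (1 - P.prob d.1.1 d.1.2))
    (by
      simp only [Fintype.sum_bool, if_true, Bool.false_eq_true, if_false]
      rw [← ENNReal.ofReal_add (P.nonneg _ _) (sub_nonneg.2 (P.le_one _ _))]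
      simp)

/-- A (possibly randomized) sequential algorithm that knows the graph but not the preference
matrix. From the history of the duels sampled so far and their outcomes it chooses, at random
with a law it specifies, either the next duel to sample or to stop and output a set of edges.
It need not stop. -/
def Algorithm (E : Finset (Fin n × Fin ℓ)) : Type :=
  List (Duel E × Bool) → PMF (Duel E ⊕ Finset E)

/-- The state of a run: the samples drawn so far, and the output if the algorithm has stopped. -/
structure RunState (E : Finset (Fin n × Fin ℓ)) where
  /-- the duels sampled so far with their outcomes, in order -/
  hist : List (Duel E × Bool)
  /-- the output, once the algorithm has stopped -/
  out : Option (Finset E)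

/-- The effect of a chosen action: draw a fresh outcome of the duel, or stop with an output. -/
def act {E : Finset (Fin n × Fin ℓ)} (P : Preference E) (h : List (Duel E × Bool)) :
    Duel E ⊕ Finset E → PMF (RunState E)
  | Sum.inl d => (P.observe d).map fun b => ⟨h ++ [(d, b)], none⟩
  | Sum.inr M => PMF.pure ⟨h, some M⟩

/-- One round of the algorithm; a stopped algorithm does nothing any more. -/
def Algorithm.step {E : Finset (Fin n × Fin ℓ)} (A : Algorithm E) (P : Preference E)
    (s : RunState E) : PMF (RunState E) :=
  match s.out with
  | some _ => PMF.pure s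
  | none => (A s.hist).bind (act P s.hist)

/-- The law of the state after `t` rounds when the preference matrix is `P`. -/
def Algorithm.law {E : Finset (Fin n × Fin ℓ)} (A : Algorithm E) (P : Preference E) :
    ℕ → PMF (RunState E)
  | 0 => PMF.pure ⟨[], none⟩
  | t + 1 => (A.law P t).bind (A.step P)

/-- The probability that the algorithm stops and outputs `M`: the increasing limit of the
probabilities that it has done so within `t` rounds. -/
def Algorithm.outputProb {E : Finset (Fin n × Fin ℓ)} (A : Algorithm E) (P : Preference E)
    (M : Finset E) : ℝ≥0∞ :=
  ⨆ t : ℕ, (A.law P t).toOuterMeasure {s | s.out = some M}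

/-- The expected total number of samples: the increasing limit of the expected number of samples
drawn within the first `t` rounds (possibly infinite). -/
def Algorithm.expectedSamples {E : Finset (Fin n × Fin ℓ)} (A : Algorithm E)
    (P : Preference E) : ℝ≥0∞ :=
  ⨆ t : ℕ, ∑' s : RunState E, A.law P t s * (s.hist.length : ℝ≥0∞)

/-- The algorithm is `δ`-correct: for every preference matrix that has a Condorcet winner, it
identifies this winner with probability at least `1 - δ`. -/
def Algorithm.IsCorrect {E : Finset (Fin n × Fin ℓ)} (A : Algorithm E) (δ : ℝ) : Prop :=
  ∀ (P : Preference E) (M : Finset E), P.IsCondorcetWinner M →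
    ENNReal.ofReal (1 - δ) ≤ A.outputProb P M

end CPEDB

end

namespace CPEDB

variable {n ℓ : ℕ} {E : Finset (Fin n × Fin ℓ)}

/-! Let `e ∉ Mstar` have finite gap `Δ`, attained at a matching `M` containing `e`. Raise by `η =
3/2 * ℓΔ` the probability that `e` wins its duels. Then `M` becomes the Condorcet winner
(`boost_isCondorcetWinner`): a matching that beat `M` contains `Mstar \ M`, so it has another edge
at the position of `e` and misses the boost; its lead over `M` was at most that of `Mstar`, so the
boost outweighs it. A matching that lost to `M` still loses.

A correct algorithm must tell the two instances apart, and they differ only on duels involving `e`.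
Each such sample carries information of order `η²`, so about `log (1/δ) / (ℓΔ)²` of them are needed
on `P` (`log_le_mean_samplesOf`). A duel involves at most two edges, so these bounds add up over `e`
at the cost of a factor 2.

This needs `ℓΔ ≤ 1/6`, to keep the probabilities inside `[0, 1]`. If `ℓΔ > 1/6`, then the candidate
of `e` occurs in `Mstar`, for otherwise putting `e` into `Mstar` would give `ℓΔ ≤ γ`. There are at
most `ℓ²` such edges, each contributing at most `36 log (1/δ)`. Boosting all of `M \ Mstar` by `3/2
* γ` shows that order `log (1/δ) / γ²` samples are needed, and this pays for them because `γℓ ≤ 1/2`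
(`log_mul_sq_le_mean_samples`). -/

noncomputable instance : Fintype (Duel E) :=
  inferInstanceAs (Fintype {d : E × E // pos d.1 = pos d.2})

/-! ### Expectations along a run, as iterates of a transition operator on real functions -/

/-- The probability that the duel is won by its first edge. -/
def Preference.win (P : Preference E) (d : Duel E) : ℝ := P.prob d.1.1 d.1.2

/-- The mean of `g` over the state reached from history `h` by a given action. -/
def Preference.actMean (P : Preference E) (h : List (Duel E × Bool)) (g : RunState E → ℝ) :
    Duel E ⊕ Finset E → ℝ
  | Sum.inl d => P.win d * g ⟨h ++ [(d, true)], none⟩ + (1 - P.win d) * g ⟨h ++ [(d, false)], none⟩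
  | Sum.inr M => g ⟨h, some M⟩

lemma Preference.win_nonneg (P : Preference E) (d : Duel E) : 0 ≤ P.win d := P.nonneg _ _

lemma Preference.win_le_one (P : Preference E) (d : Duel E) : P.win d ≤ 1 := P.le_one _ _

/-- The transition operator of a run: `stepMean A P g s` is the mean of `g` one round after
state `s`. -/
noncomputable def Algorithm.stepMean (A : Algorithm E) (P : Preference E) :
    (RunState E → ℝ) →ₗ[ℝ] (RunState E → ℝ) where
  toFun g s := match s.out with
    | some _ => g s
    | none => ∑ a, (A s.hist a).toReal * P.actMean s.hist g a
  map_add' g g' := by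
    funext s
    rcases s with ⟨h, _ | M⟩
    · simp only [Pi.add_apply]
      rw [← Finset.sum_add_distrib]
      refine Finset.sum_congr rfl fun a _ => ?_
      rcases a with d | M <;> simp only [Preference.actMean, Pi.add_apply] <;> ring
    · rfl
  map_smul' c g := by
    funext s
    rcases s with ⟨h, _ | M⟩
    · simp only [Pi.smul_apply, smul_eq_mul, RingHom.id_apply]
      rw [Finset.mul_sum]
      refine Finset.sum_congr rfl fun a _ => ?_
      rcases a with d | M <;> simp only [Preference.actMean, Pi.smul_apply, smul_eq_mul] <;> ring
    · rfl

lemma Algorithm.stepMean_none (A : Algorithm E) (P : Preference E) (g : RunState E → ℝ)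
    (h : List (Duel E × Bool)) :
    A.stepMean P g ⟨h, none⟩ = ∑ a, (A h a).toReal * P.actMean h g a := rfl

lemma Algorithm.stepMean_some (A : Algorithm E) (P : Preference E) (g : RunState E → ℝ)
    (h : List (Duel E × Bool)) (M : Finset E) :
    A.stepMean P g ⟨h, some M⟩ = g ⟨h, some M⟩ := rfl

lemma Preference.actMean_mono (P : Preference E) (h : List (Duel E × Bool))
    {g g' : RunState E → ℝ} (hg : g ≤ g') (a : Duel E ⊕ Finset E) :
    P.actMean h g a ≤ P.actMean h g' a := by
  rcases a with d | M
  · exact add_le_add (mul_le_mul_of_nonneg_left (hg _) (P.win_nonneg d))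
      (mul_le_mul_of_nonneg_left (hg _) (sub_nonneg.2 (P.win_le_one d)))
  · exact hg _

lemma Algorithm.stepMean_mono (A : Algorithm E) (P : Preference E) : Monotone (A.stepMean P) := by
  intro g g' hg s
  rcases s with ⟨h, _ | M⟩
  · rw [stepMean_none, stepMean_none]
    exact Finset.sum_le_sum fun a _ =>
      mul_le_mul_of_nonneg_left (P.actMean_mono h hg a) ENNReal.toReal_nonneg
  · exact hg _

lemma sum_toReal_eq_one {α : Type*} [Fintype α] (p : PMF α) : ∑ a, (p a).toReal = 1 := by
  rw [← ENNReal.toReal_sum fun a _ => p.apply_ne_top a, ← tsum_fintype (L := .unconditional _), p.tsum_coe,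
    ENNReal.toReal_one]

/-- It suffices to bound the change of `g` over each possible action. -/
lemma Algorithm.le_stepMean (A : Algorithm E) (P : Preference E) {g : RunState E → ℝ}
    (hg : ∀ h a, g ⟨h, none⟩ ≤ P.actMean h g a) : g ≤ A.stepMean P g := by
  rintro ⟨h, _ | M⟩
  · rw [stepMean_none]
    calc g ⟨h, none⟩ = ∑ a, (A h a).toReal * g ⟨h, none⟩ := by
          rw [← Finset.sum_mul, sum_toReal_eq_one, one_mul]
      _ ≤ _ := Finset.sum_le_sum fun a _ =>
          mul_le_mul_of_nonneg_left (hg h a) ENNReal.toReal_nonneg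
  · exact le_rfl

lemma Algorithm.stepMean_one (A : Algorithm E) (P : Preference E) : A.stepMean P 1 = 1 := by
  funext s
  rcases s with ⟨h, _ | M⟩
  · rw [stepMean_none]
    simp only [Pi.one_apply]
    rw [← sum_toReal_eq_one (A h)]
    refine Finset.sum_congr rfl fun a _ => ?_
    rcases a with d | M <;> simp [Preference.actMean]
  · rfl

/-- The mean of `g` over the state after `t` rounds. -/
noncomputable def Algorithm.mean (A : Algorithm E) (P : Preference E) (t : ℕ) :
    (RunState E → ℝ) →ₗ[ℝ] ℝ :=
  LinearMap.proj (⟨[], none⟩ : RunState E) ∘ₗ (A.stepMean P ^ t)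

lemma Algorithm.mean_zero (A : Algorithm E) (P : Preference E) (g : RunState E → ℝ) :
    A.mean P 0 g = g ⟨[], none⟩ := rfl

lemma Algorithm.mean_succ (A : Algorithm E) (P : Preference E) (t : ℕ) (g : RunState E → ℝ) :
    A.mean P (t + 1) g = A.mean P t (A.stepMean P g) := by
  simp [mean, pow_succ]

lemma Algorithm.mean_mono (A : Algorithm E) (P : Preference E) (t : ℕ) :
    Monotone (A.mean P t) := by
  induction t with
  | zero => exact fun g g' h => h _
  | succ t ih =>
    intro g g' h
    rw [mean_succ, mean_succ]
    exact ih (A.stepMean_mono P h)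

lemma Algorithm.mean_nonneg (A : Algorithm E) (P : Preference E) (t : ℕ) {g : RunState E → ℝ}
    (hg : 0 ≤ g) : 0 ≤ A.mean P t g := by
  simpa using A.mean_mono P t hg

lemma Algorithm.mean_one (A : Algorithm E) (P : Preference E) (t : ℕ) : A.mean P t 1 = 1 := by
  induction t with
  | zero => rfl
  | succ t ih => rw [mean_succ, stepMean_one, ih]

/-- Submartingales have nondecreasing means. No integrability is needed, since each state has
finitely many successors. -/
lemma Algorithm.mean_le_mean_of_le_stepMean (A : Algorithm E) (P : Preference E)
    {g : RunState E → ℝ} (hg : g ≤ A.stepMean P g) : Monotone fun t => A.mean P t g :=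
  monotone_nat_of_le_succ fun t => by
    rw [mean_succ]
    exact A.mean_mono P t hg

/-! ### Comparison with the law of the run -/

lemma tsum_bind_mul {α β : Type*} (p : PMF α) (f : α → PMF β) (G : β → ℝ≥0∞) :
    ∑' b, (p.bind f) b * G b = ∑' a, p a * ∑' b, f a b * G b := by
  simp_rw [PMF.bind_apply, ← ENNReal.tsum_mul_right, ← ENNReal.tsum_mul_left]
  rw [ENNReal.tsum_comm]
  simp_rw [mul_assoc]

lemma tsum_pure_mul {α : Type*} (a : α) (G : α → ℝ≥0∞) :
    ∑' b, (PMF.pure a) b * G b = G a := by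
  rw [tsum_eq_single a]
  · simp
  · intro b hb
    simp [PMF.pure_apply, hb]

lemma tsum_act_mul (P : Preference E) (h : List (Duel E × Bool)) (a : Duel E ⊕ Finset E)
    {g : RunState E → ℝ} (hg : 0 ≤ g) :
    ∑' s, act P h a s * ENNReal.ofReal (g s) = ENNReal.ofReal (P.actMean h g a) := by
  rcases a with d | M
  · simp only [act, Preference.actMean]
    rw [PMF.map, tsum_bind_mul, tsum_fintype, Fintype.sum_bool]
    simp only [Function.comp_apply, tsum_pure_mul]
    rw [ENNReal.ofReal_add (mul_nonneg (P.win_nonneg d) (hg _))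
        (mul_nonneg (sub_nonneg.2 (P.win_le_one d)) (hg _)),
      ENNReal.ofReal_mul (P.win_nonneg d), ENNReal.ofReal_mul (sub_nonneg.2 (P.win_le_one d))]
    rfl
  · simp only [act, Preference.actMean]
    rw [tsum_pure_mul]

lemma Preference.actMean_nonneg (P : Preference E) (h : List (Duel E × Bool))
    {g : RunState E → ℝ} (hg : 0 ≤ g) (a : Duel E ⊕ Finset E) : 0 ≤ P.actMean h g a := by
  have := P.actMean_mono h hg a
  rcases a with d | M <;> simpa [Preference.actMean] using this

lemma tsum_step_mul (A : Algorithm E) (P : Preference E) (s : RunState E)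
    {g : RunState E → ℝ} (hg : 0 ≤ g) :
    ∑' r, A.step P s r * ENNReal.ofReal (g r) = ENNReal.ofReal (A.stepMean P g s) := by
  rcases s with ⟨h, _ | M⟩
  · simp only [Algorithm.step]
    rw [tsum_bind_mul, tsum_fintype, Algorithm.stepMean_none, ENNReal.ofReal_sum_of_nonneg]
    · refine Finset.sum_congr rfl fun a _ => ?_
      rw [tsum_act_mul P h a hg, ENNReal.ofReal_mul ENNReal.toReal_nonneg,
        ENNReal.ofReal_toReal ((A h).apply_ne_top a)]
    · exact fun a _ => mul_nonneg ENNReal.toReal_nonneg (P.actMean_nonneg h hg a)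
  · simp only [Algorithm.step]
    rw [tsum_pure_mul, Algorithm.stepMean_some]

/-- Carries real-valued estimates over to `outputProb` and `expectedSamples`. Nonnegativity matters,
as `ENNReal.ofReal` truncates. -/
lemma tsum_law_mul (A : Algorithm E) (P : Preference E) (t : ℕ) {g : RunState E → ℝ}
    (hg : 0 ≤ g) :
    ∑' s, A.law P t s * ENNReal.ofReal (g s) = ENNReal.ofReal (A.mean P t g) := by
  induction t generalizing g with
  | zero => rw [Algorithm.law, tsum_pure_mul, Algorithm.mean_zero]
  | succ t ih =>
    rw [Algorithm.law, tsum_bind_mul, Algorithm.mean_succ,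
      ← ih (by simpa using A.stepMean_mono P hg)]
    simp_rw [tsum_step_mul A P _ hg]

/-! ### Output events and the number of samples -/

open Classical in
/-- The indicator of the event that the algorithm has output `M`. -/
noncomputable def outputs (M : Finset E) (s : RunState E) : ℝ := if s.out = some M then 1 else 0

lemma outputs_nonneg (M : Finset E) : 0 ≤ outputs M := by
  intro s
  unfold outputs
  split_ifs <;> simp

lemma outputs_add_le {M N : Finset E} (h : M ≠ N) : outputs M + outputs N ≤ 1 := by
  intro s
  simp only [outputs, Pi.add_apply, Pi.one_apply]
  split_ifs with h1 h2
  · exact absurd (Option.some.inj (h1.symm.trans h2)) h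
  all_goals norm_num

lemma outputs_le_stepMean (A : Algorithm E) (P : Preference E) (M : Finset E) :
    outputs M ≤ A.stepMean P (outputs M) := by
  refine A.le_stepMean P fun h a => ?_
  simpa [outputs] using P.actMean_nonneg h (outputs_nonneg M) a

lemma law_outputs (A : Algorithm E) (P : Preference E) (M : Finset E) (t : ℕ) :
    (A.law P t).toOuterMeasure {s | s.out = some M} = ENNReal.ofReal (A.mean P t (outputs M)) := by
  rw [PMF.toOuterMeasure_apply, ← tsum_law_mul A P t (outputs_nonneg M)]
  refine tsum_congr fun s => ?_
  by_cases h : s.out = some M <;> simp [outputs, h]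

/-- The output probability is a supremum over horizons, so any smaller value is exceeded at a finite
one. The later arguments thus work at a fixed `t`, without almost sure termination. -/
lemma exists_mean_outputs_gt (A : Algorithm E) (P : Preference E) (M : Finset E) {x y : ℝ}
    (hxy : x < y) (hy : 0 < y) (h : ENNReal.ofReal y ≤ A.outputProb P M) :
    ∃ t, x < A.mean P t (outputs M) := by
  have h2 : ENNReal.ofReal x < A.outputProb P M :=
    lt_of_lt_of_le ((ENNReal.ofReal_lt_ofReal_iff hy).2 hxy) h
  obtain ⟨t, ht⟩ := lt_iSup_iff.1 h2
  rw [law_outputs] at ht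
  exact ⟨t, (ENNReal.ofReal_lt_ofReal_iff'.1 ht).1⟩

/-- An output is never withdrawn, so both probabilities can be compared at the later of the two
horizons, where the events are disjoint. -/
lemma mean_outputs_add_le (A : Algorithm E) (P : Preference E) {M N : Finset E} (h : M ≠ N)
    (t t' : ℕ) : A.mean P t (outputs M) + A.mean P t' (outputs N) ≤ 1 := by
  have h1 := A.mean_le_mean_of_le_stepMean P (outputs_le_stepMean A P M) (le_max_left t t')
  have h2 := A.mean_le_mean_of_le_stepMean P (outputs_le_stepMean A P N) (le_max_right t t')
  have h3 := A.mean_mono P (max t t') (outputs_add_le h)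
  rw [map_add, A.mean_one] at h3
  simp only at h1 h2
  linarith

/-- The number of samples as a function of the state. -/
def samples (s : RunState E) : ℝ := s.hist.length

lemma mean_samples_le (A : Algorithm E) (P : Preference E) (t : ℕ) :
    ENNReal.ofReal (A.mean P t samples) ≤ A.expectedSamples P := by
  rw [← tsum_law_mul A P t (g := samples) fun s => Nat.cast_nonneg _]
  refine le_iSup_of_le t (le_of_eq ?_)
  simp [samples]

/-! ### Change of measure -/

/-- The factor of the likelihood ratio contributed by one outcome. -/
noncomputable def ratio (P Q : Preference E) (o : Duel E × Bool) : ℝ :=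
  if o.2 then Q.win o.1 / P.win o.1 else (1 - Q.win o.1) / (1 - P.win o.1)

/-- The likelihood ratio of `Q` against `P` for the history of a state. -/
noncomputable def likelihood (P Q : Preference E) (s : RunState E) : ℝ :=
  (s.hist.map (ratio P Q)).prod

/-- All duels have outcome probabilities in the open unit interval. -/
def Preference.Interior (P : Preference E) : Prop := ∀ d, 0 < P.win d ∧ P.win d < 1

lemma ratio_pos {P Q : Preference E} (hP : P.Interior) (hQ : Q.Interior) (o : Duel E × Bool) :
    0 < ratio P Q o := by
  unfold ratio
  split_ifs
  · exact div_pos (hQ _).1 (hP _).1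
  · exact div_pos (sub_pos.2 (hQ _).2) (sub_pos.2 (hP _).2)

lemma likelihood_pos {P Q : Preference E} (hP : P.Interior) (hQ : Q.Interior) (s : RunState E) :
    0 < likelihood P Q s := by
  refine List.prod_pos fun x hx => ?_
  obtain ⟨o, -, rfl⟩ := List.mem_map.1 hx
  exact ratio_pos hP hQ o

lemma likelihood_snoc (P Q : Preference E) (h : List (Duel E × Bool)) (o : Duel E × Bool)
    (x y : Option (Finset E)) :
    likelihood P Q ⟨h ++ [o], x⟩ = likelihood P Q ⟨h, y⟩ * ratio P Q o := by
  simp [likelihood]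

/-- The law of the chosen action is the same under `P` and `Q`; only the outcome is reweighted, and
its `P`-probability cancels the denominator of `ratio`. -/
lemma actMean_likelihood_mul {P : Preference E} (Q : Preference E) (hP : P.Interior)
    (g : RunState E → ℝ) (h : List (Duel E × Bool)) (a : Duel E ⊕ Finset E) :
    P.actMean h (likelihood P Q * g) a = likelihood P Q ⟨h, none⟩ * Q.actMean h g a := by
  rcases a with d | M
  · simp only [Preference.actMean, Pi.mul_apply, likelihood_snoc P Q h _ none none]
    have h1 := (hP d).1.ne'
    have h2 := (sub_pos.2 (hP d).2).ne'
    simp only [ratio, if_true, Bool.false_eq_true, if_false]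
    field_simp
  · rfl

lemma stepMean_likelihood_mul (A : Algorithm E) {P : Preference E} (Q : Preference E)
    (hP : P.Interior) (g : RunState E → ℝ) :
    A.stepMean P (likelihood P Q * g) = likelihood P Q * A.stepMean Q g := by
  funext s
  rcases s with ⟨h, _ | M⟩
  · rw [Pi.mul_apply, Algorithm.stepMean_none, Algorithm.stepMean_none, Finset.mul_sum]
    refine Finset.sum_congr rfl fun a _ => ?_
    rw [actMean_likelihood_mul Q hP]
    ring
  · rfl

lemma mean_likelihood_mul (A : Algorithm E) {P : Preference E} (Q : Preference E)
    (hP : P.Interior) (t : ℕ) (g : RunState E → ℝ) :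
    A.mean P t (likelihood P Q * g) = A.mean Q t g := by
  induction t generalizing g with
  | zero => simp [Algorithm.mean_zero, likelihood]
  | succ t ih => rw [Algorithm.mean_succ, stepMean_likelihood_mul A Q hP, ih, Algorithm.mean_succ]

/-- The number of samples of duels in a given set. -/
noncomputable def samplesIn (D : Duel E → Prop) [DecidablePred D] (s : RunState E) : ℝ :=
  (s.hist.map fun o => if D o.1 then (1 : ℝ) else 0).sum

/-- The Kullback–Leibler divergence of two Bernoulli laws is at most their χ²-divergence. -/
lemma neg_sq_div_le_log {p q : ℝ} (hp : 0 < p) (hp1 : p < 1) (hq : 0 < q) (hq1 : q < 1) :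
    -((p - q) ^ 2 / (q * (1 - q))) ≤
      p * Real.log (q / p) + (1 - p) * Real.log ((1 - q) / (1 - p)) := by
  have hp' : 0 < 1 - p := by linarith
  have hq' : 0 < 1 - q := by linarith
  have h1 := Real.one_sub_inv_le_log_of_pos (div_pos hq hp)
  have h2 := Real.one_sub_inv_le_log_of_pos (div_pos hq' hp')
  have e : -((p - q) ^ 2 / (q * (1 - q))) =
      p * (1 - (q / p)⁻¹) + (1 - p) * (1 - ((1 - q) / (1 - p))⁻¹) := by
    field_simp
    ring
  rw [e]
  gcongr

/-- The log-likelihood plus `K` times the number of samples in `D` is a submartingale under `P`: its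
drift is bounded below by `neg_sq_div_le_log` on `D` and vanishes elsewhere. -/
lemma le_mean_log_likelihood (A : Algorithm E) {P Q : Preference E} (hP : P.Interior)
    (hQ : Q.Interior) (D : Duel E → Prop) [DecidablePred D] {K : ℝ}
    (hD : ∀ d, D d → (P.win d - Q.win d) ^ 2 / (Q.win d * (1 - Q.win d)) ≤ K)
    (hD' : ∀ d, ¬ D d → Q.win d = P.win d) (t : ℕ) :
    -(K * A.mean P t (samplesIn D)) ≤ A.mean P t fun s => Real.log (likelihood P Q s) := by
  have key : ((fun s => Real.log (likelihood P Q s)) + K • samplesIn D : RunState E → ℝ) ≤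
      A.stepMean P ((fun s => Real.log (likelihood P Q s)) + K • samplesIn D) := by
    refine A.le_stepMean P fun h a => ?_
    rcases a with d | M
    · simp only [Preference.actMean, Pi.add_apply, Pi.smul_apply, smul_eq_mul,
        likelihood_snoc P Q h _ none none,
        Real.log_mul (likelihood_pos hP hQ _).ne' (ratio_pos hP hQ _).ne']
      simp only [samplesIn, List.map_append, List.sum_append, List.map_cons, List.map_nil,
        List.sum_cons, List.sum_nil, add_zero, ratio, if_true, Bool.false_eq_true, if_false]
      have h1 := neg_sq_div_le_log (hP d).1 (hP d).2 (hQ d).1 (hQ d).2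
      by_cases hd : D d
      · have h2 := hD d hd
        simp only [hd, if_true]
        linarith
      · rw [hD' d hd, div_self (hP d).1.ne', div_self (sub_pos.2 (hP d).2).ne', Real.log_one]
        simp only [hd, if_false]
        linarith
    · exact le_rfl
  have h0 := A.mean_le_mean_of_le_stepMean P key (Nat.zero_le t)
  simp only [Algorithm.mean_zero, map_add, map_smul, smul_eq_mul] at h0
  simp [likelihood, samplesIn] at h0
  simp only [likelihood]
  linarith

/-- Jensen's inequality for `exp`, applied to half the log-likelihood. -/
lemma exp_neg_le_mean_sqrt_likelihood (A : Algorithm E) {P Q : Preference E} (hP : P.Interior)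
    (hQ : Q.Interior) (D : Duel E → Prop) [DecidablePred D] {K : ℝ}
    (hD : ∀ d, D d → (P.win d - Q.win d) ^ 2 / (Q.win d * (1 - Q.win d)) ≤ K)
    (hD' : ∀ d, ¬ D d → Q.win d = P.win d) (t : ℕ) :
    Real.exp (-(K * A.mean P t (samplesIn D)) / 2) ≤
      A.mean P t fun s => Real.sqrt (likelihood P Q s) := by
  set m : ℝ := -(K * A.mean P t (samplesIn D)) / 2 with hm
  have h0 := le_mean_log_likelihood A hP hQ D hD hD' t
  -- The tangent of `exp` at `m` bounds the square root of the likelihood from below by an affine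
  -- function of its logarithm.
  have h1 : (Real.exp m * (1 - m)) • (1 : RunState E → ℝ) +
      (Real.exp m / 2) • (fun s => Real.log (likelihood P Q s)) ≤
      fun s => Real.sqrt (likelihood P Q s) := by
    intro s
    have hL := likelihood_pos hP hQ s
    have h2 : Real.sqrt (likelihood P Q s) =
        Real.exp m * Real.exp (Real.log (likelihood P Q s) / 2 - m) := by
      rw [← Real.exp_add, Real.sqrt_eq_rpow, Real.rpow_def_of_pos hL]
      ring_nf
    simp only [Pi.add_apply, Pi.smul_apply, Pi.one_apply, smul_eq_mul]
    rw [h2]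
    have h3 := Real.add_one_le_exp (Real.log (likelihood P Q s) / 2 - m)
    nlinarith [mul_le_mul_of_nonneg_left h3 (Real.exp_pos m).le]
  refine le_trans ?_ (A.mean_mono P t h1)
  rw [map_add, map_smul, map_smul, A.mean_one, smul_eq_mul, smul_eq_mul]
  have h4 : 2 * m ≤ A.mean P t fun s => Real.log (likelihood P Q s) := by
    rw [hm]; linarith
  nlinarith [mul_le_mul_of_nonneg_left h4 (Real.exp_pos m).le]

/-- The mean is the Hellinger affinity of the two laws; it is small because the event of output `M`
is likely under `P` and unlikely under `Q`. -/
lemma mean_sqrt_likelihood_le (A : Algorithm E) {P Q : Preference E} (hP : P.Interior)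
    (hQ : Q.Interior) (M : Finset E) (t : ℕ) {x : ℝ} (hx : 0 < x)
    (h1 : 1 - x ^ 2 ≤ A.mean P t (outputs M)) (h2 : A.mean Q t (outputs M) ≤ x ^ 2) :
    (A.mean P t fun s => Real.sqrt (likelihood P Q s)) ≤ 2 * x := by
  -- AM-GM, weighted differently on the event and off it, so that each of the four resulting terms
  -- has mean at most `x / 2`.
  have key : (fun s => Real.sqrt (likelihood P Q s)) ≤
      (1 / (2 * x)) • (likelihood P Q * outputs M) + (x / 2) • outputs M +
      (x / 2) • (likelihood P Q * (1 - outputs M)) + (1 / (2 * x)) • (1 - outputs M) := by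
    intro s
    have hL := likelihood_pos hP hQ s
    obtain ⟨r, hr⟩ : ∃ r, r = Real.sqrt (likelihood P Q s) := ⟨_, rfl⟩
    have hr2 : likelihood P Q s = r ^ 2 := by rw [hr, Real.sq_sqrt hL.le]
    have e1 : 1 / (2 * x) * r ^ 2 + x / 2 - r = (r - x) ^ 2 / (2 * x) := by field_simp; ring
    have e2 : x / 2 * r ^ 2 + 1 / (2 * x) - r = (x * r - 1) ^ 2 / (2 * x) := by field_simp; ring
    have p1 : 0 ≤ (r - x) ^ 2 / (2 * x) := by positivity
    have p2 : 0 ≤ (x * r - 1) ^ 2 / (2 * x) := by positivity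
    simp only [Pi.add_apply, Pi.smul_apply, Pi.mul_apply, Pi.sub_apply, Pi.one_apply, smul_eq_mul]
    rw [← hr, hr2]
    unfold outputs
    split_ifs
    · linarith
    · linarith
  refine (A.mean_mono P t key).trans ?_
  simp only [map_add, map_smul, mean_likelihood_mul A Q hP, map_sub, A.mean_one, smul_eq_mul]
  have h3 : 0 ≤ A.mean Q t (outputs M) := A.mean_nonneg Q t (outputs_nonneg M)
  have h4 : A.mean P t (outputs M) ≤ 1 := by
    rw [← A.mean_one P t]
    refine A.mean_mono P t fun s => ?_
    unfold outputs
    split_ifs <;> simp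
  have h5 : 1 / (2 * x) * A.mean Q t (outputs M) ≤ 1 / (2 * x) * x ^ 2 := by gcongr
  have h6 : 1 / (2 * x) * (1 - A.mean P t (outputs M)) ≤ 1 / (2 * x) * x ^ 2 := by
    gcongr; linarith
  have h7 : 1 / (2 * x) * x ^ 2 = x / 2 := by field_simp
  have h8 : x / 2 * A.mean P t (outputs M) ≤ x / 2 * 1 := by gcongr
  have h9 : x / 2 * (1 - A.mean Q t (outputs M)) ≤ x / 2 * 1 := by gcongr; linarith
  linarith

/-- A correct algorithm must sample the duels that tell `P` from `Q` often on `P`, if the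
Condorcet winners of `P` and `Q` differ. -/
lemma log_le_mean_samplesIn {A : Algorithm E} {δ : ℝ} (hA : A.IsCorrect δ) (hδ : 0 < δ)
    (hδ' : δ < 0.1) {P Q : Preference E} (hP : P.Interior) (hQ : Q.Interior) {M N : Finset E}
    (hN : Q.IsCondorcetWinner N) (hMN : M ≠ N)
    (D : Duel E → Prop) [DecidablePred D] {K : ℝ}
    (hD : ∀ d, D d → (P.win d - Q.win d) ^ 2 / (Q.win d * (1 - Q.win d)) ≤ K)
    (hD' : ∀ d, ¬ D d → Q.win d = P.win d) {t : ℕ}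
    (ht : 1 - 3 / 2 * δ < A.mean P t (outputs M)) :
    Real.log (1 / δ) ≤ 10 * (K * A.mean P t (samplesIn D)) := by
  obtain ⟨t', ht'⟩ := exists_mean_outputs_gt A Q N (x := 1 - 3 / 2 * δ) (y := 1 - δ)
    (by linarith) (by norm_num at hδ'; linarith) (hA Q N hN)
  have h1 := mean_outputs_add_le A Q hMN t t'
  have hx : Real.sqrt (3 / 2 * δ) ^ 2 = 3 / 2 * δ := Real.sq_sqrt (by positivity)
  have h2 := mean_sqrt_likelihood_le A hP hQ M t (x := Real.sqrt (3 / 2 * δ)) (by positivity)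
    (by rw [hx]; exact ht.le) (by rw [hx]; linarith)
  have h3 := (exp_neg_le_mean_sqrt_likelihood A hP hQ D hD hD' t).trans h2
  rw [← Real.le_log_iff_exp_le (by positivity), Real.log_mul (by norm_num) (by positivity),
    Real.log_sqrt (by positivity), Real.log_mul (by norm_num) hδ.ne'] at h3
  -- The affinity bounds give `K * mean ≥ log (1/δ) - log 6`. As `6^10 ≤ 10^9` and `1/δ > 10`, the
  -- loss is at most nine tenths of `log (1/δ)`, whence the factor 10.
  have h4 : 10 * (2 * Real.log 2 + Real.log (3 / 2)) ≤ 9 * Real.log 10 := by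
    have e : 10 * (2 * Real.log 2 + Real.log (3 / 2)) = Real.log ((2 ^ 2 * (3 / 2)) ^ 10) := by
      rw [Real.log_pow, Real.log_mul (by norm_num) (by norm_num), Real.log_pow]
      norm_num
    have e' : 9 * Real.log 10 = Real.log (10 ^ 9) := by
      rw [Real.log_pow]; norm_num
    rw [e, e']
    exact Real.log_le_log (by norm_num) (by norm_num)
  have h5 : Real.log 10 ≤ Real.log (1 / δ) := by
    refine Real.log_le_log (by norm_num) ?_
    rw [le_div_iff₀ hδ]
    norm_num at hδ' ⊢
    linarith
  have h6 : Real.log (1 / δ) = -Real.log δ := by rw [one_div, Real.log_inv]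
  linarith

/-! ### Matchings that cover all positions -/

lemma IsMatching.injOn_pos {M : Finset E} (h : IsMatching M) : Set.InjOn pos (M : Set E) := by
  intro e he e' he' hee
  by_contra hne
  exact (h e he e' he' hne).2 hee

lemma IsMatching.eq_of_pos_eq {M : Finset E} (h : IsMatching M) {e e' : E} (he : e ∈ M)
    (he' : e' ∈ M) (hee : pos e = pos e') : e = e' :=
  h.injOn_pos he he' hee

lemma IsMatching.card_le {M : Finset E} (h : IsMatching M) : M.card ≤ ℓ := by
  rw [← Finset.card_image_of_injOn h.injOn_pos]
  exact (Finset.card_le_univ _).trans_eq (Fintype.card_fin ℓ)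

lemma mem_decisionClass_iff (hE : ∃ M : Finset E, IsMatching M ∧ M.card = ℓ) {M : Finset E} :
    M ∈ decisionClass E ↔ IsMatching M ∧ M.card = ℓ := by
  obtain ⟨M₀, h₀, hc₀⟩ := hE
  constructor
  · rintro ⟨h, hmax⟩
    exact ⟨h, le_antisymm h.card_le (hc₀.ge.trans (hmax M₀ h₀))⟩
  · rintro ⟨h, hc⟩
    exact ⟨h, fun N hN => hc.symm ▸ hN.card_le⟩

/-- A perfect matching has a unique edge at each position. -/
lemma IsMatching.exists_mem_pos_eq {M : Finset E} (h : IsMatching M) (hc : M.card = ℓ)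
    (j : Fin ℓ) : ∃ e ∈ M, pos e = j := by
  have h1 : M.image pos = Finset.univ := by
    rw [← Finset.card_eq_iff_eq_univ, Finset.card_image_of_injOn h.injOn_pos, hc,
      Fintype.card_fin]
  have h2 : j ∈ M.image pos := h1 ▸ Finset.mem_univ j
  simpa using h2

lemma IsMatching.sum_eq {M : Finset E} (h : IsMatching M) {e : E} (he : e ∈ M) {g : E → ℝ}
    (hg : ∀ e', pos e ≠ pos e' → g e' = 0) : ∑ e' ∈ M, g e' = g e :=
  Finset.sum_eq_single_of_mem e he fun e' he' hne => hg e' (h e he e' he' hne.symm).2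

lemma Preference.prob_self (P : Preference E) (e : E) : P.prob e e = 1 / 2 := by
  linarith [P.add_swap e e rfl]

/-- Only positions where `M` and `N` differ can deviate from `1/2`, each by at most `γ`. -/
lemma Preference.half_sub_le_f {P : Preference E} {γ : ℝ} (hγ : ∀ e e' : E, pos e = pos e' →
    1 / 2 - γ ≤ P.prob e e') {M N : Finset E} (hM : M.card = ℓ) (hN : IsMatching N)
    (hNc : N.card = ℓ) (hℓ : 0 < ℓ) :
    1 / 2 - γ * (M \ N).card / ℓ ≤ P.f M N := by
  have hℓ' : (0 : ℝ) < ℓ := Nat.cast_pos.2 hℓ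
  have h1 : ∀ e ∈ M, 1 / 2 - (if e ∈ N then 0 else γ) ≤ ∑ e' ∈ N, P.prob e e' := by
    intro e _
    obtain ⟨x, hx, hxe⟩ := hN.exists_mem_pos_eq hNc (pos e)
    rw [hN.sum_eq hx fun e' he' => P.incomparable e e' (hxe ▸ he')]
    split_ifs with h
    · rw [hN.eq_of_pos_eq hx h hxe, P.prob_self]
      norm_num
    · exact hγ e x hxe.symm
  have h2 := Finset.sum_le_sum h1
  rw [Finset.sum_sub_distrib, Finset.sum_const, hM, Finset.sum_ite, Finset.sum_const_zero,
    Finset.sum_const, zero_add, ← Finset.sdiff_eq_filter, nsmul_eq_mul, nsmul_eq_mul] at h2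
  unfold Preference.f
  calc 1 / 2 - γ * (M \ N).card / ℓ = 1 / ℓ * (ℓ * (1 / 2) - (M \ N).card * γ) := by
        field_simp
    _ ≤ _ := by gcongr

/-! ### The boosted instance and its Condorcet winner -/

/-- `1` on the members of `F` and `0` elsewhere. -/
noncomputable def ind (F : Finset E) (e : E) : ℝ := if e ∈ F then 1 else 0

lemma ind_sub_mem (F : Finset E) (e e' : E) : |ind F e - ind F e'| ≤ 1 := by
  unfold ind
  split_ifs <;> norm_num

/-- The preference matrix in which the edges in `F` win with an additional probability `η`. -/
noncomputable def Preference.boost (P : Preference E) (F : Finset E) (η : ℝ)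
    (h : ∀ e e' : E, pos e = pos e' → |η| ≤ P.prob e e') : Preference E where
  prob e e' := P.prob e e' + if pos e = pos e' then η * (ind F e - ind F e') else 0
  nonneg e e' := by
    split_ifs with hp
    · have h1 : |η * (ind F e - ind F e')| ≤ |η| := by
        rw [abs_mul]
        exact mul_le_of_le_one_right (abs_nonneg _) (ind_sub_mem F e e')
      linarith [neg_abs_le (η * (ind F e - ind F e')), h e e' hp]
    · simpa using P.nonneg e e'
  le_one e e' := by
    split_ifs with hp
    · have h1 : |η * (ind F e - ind F e')| ≤ |η| := by
        rw [abs_mul]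
        exact mul_le_of_le_one_right (abs_nonneg _) (ind_sub_mem F e e')
      linarith [le_abs_self (η * (ind F e - ind F e')), h e' e hp.symm, P.add_swap e e' hp]
    · simpa using P.le_one e e'
  add_swap e e' hp := by
    rw [if_pos hp, if_pos hp.symm]
    linarith [P.add_swap e e' hp]
  incomparable e e' hp := by
    rw [if_neg hp, P.incomparable e e' hp, add_zero]

lemma IsMatching.sum_ite_pos {N : Finset E} (hN : IsMatching N) (hNc : N.card = ℓ) (e : E)
    (c : ℝ) : (∑ e' ∈ N, if pos e = pos e' then c else 0) = c := by
  obtain ⟨x, hx, hxe⟩ := hN.exists_mem_pos_eq hNc (pos e)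
  rw [hN.sum_eq hx fun e' he' => if_neg (hxe ▸ he'), if_pos hxe.symm]

lemma sum_ind (F M : Finset E) : ∑ e ∈ M, ind F e = (M ∩ F).card := by
  simp only [ind]
  rw [Finset.sum_boole, Finset.filter_mem_eq_inter]

lemma Preference.f_boost (P : Preference E) {F : Finset E} {η : ℝ}
    (h : ∀ e e' : E, pos e = pos e' → |η| ≤ P.prob e e') {M N : Finset E}
    (hM : IsMatching M) (hMc : M.card = ℓ) (hN : IsMatching N) (hNc : N.card = ℓ) :
    (P.boost F η h).f M N = P.f M N + η / ℓ * ((M ∩ F).card - (N ∩ F).card) := by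
  have h1 : ∑ e ∈ M, ∑ e' ∈ N, (if pos e = pos e' then η * ind F e else 0) =
      η * (M ∩ F).card := by
    rw [← sum_ind, Finset.mul_sum]
    exact Finset.sum_congr rfl fun e _ => hN.sum_ite_pos hNc e _
  have h2 : ∑ e ∈ M, ∑ e' ∈ N, (if pos e = pos e' then η * ind F e' else 0) =
      η * (N ∩ F).card := by
    rw [Finset.sum_comm, ← sum_ind, Finset.mul_sum]
    refine Finset.sum_congr rfl fun e' _ => ?_
    refine Eq.trans ?_ (hM.sum_ite_pos hMc e' (η * ind F e'))
    exact Finset.sum_congr rfl fun e _ => if_congr eq_comm rfl rfl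
  have h3 : ∑ e ∈ M, ∑ e' ∈ N, (P.boost F η h).prob e e' =
      ∑ e ∈ M, ∑ e' ∈ N, P.prob e e' + (η * (M ∩ F).card - η * (N ∩ F).card) := by
    rw [← h1, ← h2]
    simp only [← Finset.sum_sub_distrib, ← Finset.sum_add_distrib]
    refine Finset.sum_congr rfl fun e _ => Finset.sum_congr rfl fun e' _ => ?_
    simp only [Preference.boost]
    split_ifs <;> ring
  unfold Preference.f
  rw [h3]
  ring

lemma Preference.f_add_f_swap (P : Preference E) {M N : Finset E}
    (hMc : M.card = ℓ) (hN : IsMatching N) (hNc : N.card = ℓ) (hℓ : 0 < ℓ) :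
    P.f M N + P.f N M = 1 := by
  have hℓ' : (0 : ℝ) < ℓ := Nat.cast_pos.2 hℓ
  have h1 : ∑ e ∈ M, ∑ e' ∈ N, P.prob e e' + ∑ e ∈ N, ∑ e' ∈ M, P.prob e e' = ℓ := by
    rw [Finset.sum_comm (s := N), ← Finset.sum_add_distrib]
    simp only [← Finset.sum_add_distrib]
    calc _ = ∑ e ∈ M, ∑ e' ∈ N, (if pos e = pos e' then (1 : ℝ) else 0) := by
          refine Finset.sum_congr rfl fun e _ => Finset.sum_congr rfl fun e' _ => ?_
          split_ifs with hp
          · exact P.add_swap e e' hp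
          · rw [P.incomparable e e' hp, P.incomparable e' e (Ne.symm hp), add_zero]
      _ = ∑ e ∈ M, 1 := Finset.sum_congr rfl fun e _ => hN.sum_ite_pos hNc e 1
      _ = ℓ := by simp [hMc]
  unfold Preference.f
  rw [← mul_add, h1]
  field_simp

/-- Boosting edges of `M` that are not in the Condorcet winner by enough to let `M` win against
it makes `M` the Condorcet winner. -/
lemma Preference.boost_isCondorcetWinner (hE : ∃ M : Finset E, IsMatching M ∧ M.card = ℓ)
    {P : Preference E} {Mstar M : Finset E} (hstar : P.IsCondorcetWinner Mstar)
    (hM : M ∈ decisionClass E)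
    (hbeat : ∀ N ∈ P.beaters M, P.f M Mstar ≤ P.f M N ∧ Mstar \ M ⊆ N \ M)
    {F : Finset E} (hF : F ⊆ M \ Mstar) {η : ℝ} (hη : 0 ≤ η)
    (h : ∀ e e' : E, pos e = pos e' → |η| ≤ P.prob e e')
    (hwin : 1 / 2 - P.f M Mstar < η * F.card / ℓ) (hℓ : 0 < ℓ) :
    (P.boost F η h).IsCondorcetWinner M := by
  refine ⟨hM, fun N hN hNM => ?_⟩
  obtain ⟨m1, m2⟩ := (mem_decisionClass_iff hE).1 hM
  obtain ⟨n1, n2⟩ := (mem_decisionClass_iff hE).1 hN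
  obtain ⟨s1, s2⟩ := (mem_decisionClass_iff hE).1 hstar.1
  rw [P.f_boost h m1 m2 n1 n2,
    Finset.inter_eq_right.2 (hF.trans Finset.sdiff_subset)]
  by_cases hb : N ∈ P.beaters M
  · obtain ⟨hb1, hb2⟩ := hbeat N hb
    -- At the position of an edge of `F`, `Mstar` has an edge outside `M`. The beater `N` contains
    -- that edge, hence not the edge of `F`.
    have hNF : N ∩ F = ∅ := by
      refine Finset.eq_empty_of_forall_notMem fun x hx => ?_
      obtain ⟨hxN, hxF⟩ := Finset.mem_inter.1 hx
      obtain ⟨hxM, hxs⟩ := Finset.mem_sdiff.1 (hF hxF)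
      obtain ⟨y, hy, hyx⟩ := s1.exists_mem_pos_eq s2 (pos x)
      have hyM : y ∉ M := fun hyM => hxs (m1.eq_of_pos_eq hyM hxM hyx ▸ hy)
      have hyN := (Finset.mem_sdiff.1 (hb2 (Finset.mem_sdiff.2 ⟨hy, hyM⟩))).1
      exact hyM (n1.eq_of_pos_eq hyN hxN hyx ▸ hxM)
    rw [hNF, Finset.card_empty, Nat.cast_zero, sub_zero]
    have : η / ℓ * F.card = η * F.card / ℓ := by ring
    linarith
  · have h1 : P.f N M < 1 / 2 := by
      by_contra h1
      exact hb ⟨hN, hNM, not_lt.1 h1⟩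
    have h2 := P.f_add_f_swap m2 n1 n2 hℓ
    have h3 : ((N ∩ F).card : ℝ) ≤ F.card :=
      Nat.cast_le.2 (Finset.card_le_card Finset.inter_subset_right)
    have h4 : 0 ≤ η / ℓ * (F.card - (N ∩ F).card) :=
      mul_nonneg (by positivity) (sub_nonneg.2 h3)
    linarith

/-! ### Exchanging one edge, counting edges, and attaining the gap -/

/-- Replacing the edge of a perfect matching at the position of `e` by `e` gives a perfect
matching, if the matching does not use the candidate of `e`. -/
lemma IsMatching.exists_swap {M : Finset E} (hM : IsMatching M) (hMc : M.card = ℓ) {e : E}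
    (he : cand e ∉ M.image cand) :
    ∃ N : Finset E, IsMatching N ∧ N.card = ℓ ∧ e ∈ N ∧ (N \ M).card ≤ 1 := by
  obtain ⟨x, hx, hxe⟩ := hM.exists_mem_pos_eq hMc (pos e)
  have hc : ∀ y ∈ M, cand y ≠ cand e := fun y hy h => he (Finset.mem_image.2 ⟨y, hy, h⟩)
  have heM : e ∉ M := fun h => hc e h rfl
  refine ⟨insert e (M.erase x), ?_, ?_, Finset.mem_insert_self _ _, ?_⟩
  · have hp : ∀ y ∈ M.erase x, pos y ≠ pos e := fun y hy h =>
      (Finset.mem_erase.1 hy).1 (hM.eq_of_pos_eq (Finset.mem_erase.1 hy).2 hx (h.trans hxe.symm))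
    intro y hy z hz hyz
    rcases Finset.mem_insert.1 hy with rfl | hy' <;> rcases Finset.mem_insert.1 hz with rfl | hz'
    · exact absurd rfl hyz
    · exact ⟨(hc z (Finset.mem_of_mem_erase hz')).symm, (hp z hz').symm⟩
    · exact ⟨hc y (Finset.mem_of_mem_erase hy'), hp y hy'⟩
    · exact hM y (Finset.mem_of_mem_erase hy') z (Finset.mem_of_mem_erase hz') hyz
  · rw [Finset.card_insert_of_notMem fun h => heM (Finset.mem_of_mem_erase h),
      Finset.card_erase_add_one hx, hMc]
  · refine (Finset.card_le_card (t := {e}) fun y hy => ?_).trans_eq (Finset.card_singleton e)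
    obtain ⟨hy1, hy2⟩ := Finset.mem_sdiff.1 hy
    rcases Finset.mem_insert.1 hy1 with rfl | h
    · simp
    · exact absurd (Finset.mem_of_mem_erase h) hy2

lemma IsMatching.card_filter_cand_le {M : Finset E} (hM : IsMatching M) :
    (Finset.univ.filter fun e : E => cand e ∈ M.image cand).card ≤ ℓ * ℓ := by
  calc _ ≤ (M.image cand ×ˢ (Finset.univ : Finset (Fin ℓ))).card := by
        refine Finset.card_le_card_of_injOn (fun e => (cand e, pos e)) ?_ ?_
        · intro e he
          simpa using he
        · intro e _ e' _ h
          exact Subtype.ext h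
    _ ≤ ℓ * ℓ := by
        rw [Finset.card_product, Finset.card_univ, Fintype.card_fin]
        exact Nat.mul_le_mul_right _ (Finset.card_image_le.trans hM.card_le)

/-- The gap of an edge outside the Condorcet winner is infinite or attained. -/
lemma Preference.gap_eq_top_or (P : Preference E) {Mstar : Finset E} {e : E} (he : e ∉ Mstar) :
    P.gap Mstar e = ⊤ ∨ ∃ M ∈ decisionClass E, e ∈ M ∧
      P.gap Mstar e = ((1 / 2 - P.f M Mstar : ℝ) : EReal) ∧
      ∀ N ∈ decisionClass E, e ∈ N → P.f N Mstar ≤ P.f M Mstar := by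
  classical
  unfold Preference.gap
  rw [if_neg he]
  rcases Set.eq_empty_or_nonempty {M | M ∈ decisionClass E ∧ e ∈ M} with h | h
  · left
    rw [h]
    simp
  · right
    obtain ⟨M, ⟨hM, heM⟩, hmax⟩ := Set.exists_max_image _ (fun M => P.f M Mstar) (Set.toFinite _) h
    refine ⟨M, hM, heM, ?_, fun N hN heN => hmax N ⟨hN, heN⟩⟩
    rw [EReal.coe_sub]
    congr 1
    refine le_antisymm (iSup₂_le fun N hN => EReal.coe_le_coe_iff.2 (hmax N hN)) ?_
    exact le_iSup₂_of_le (f := fun N (_ : N ∈ {M | M ∈ decisionClass E ∧ e ∈ M}) =>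
      (P.f N Mstar : EReal)) M ⟨hM, heM⟩ le_rfl

/-! ### The lower bound -/

open Classical in
/-- The number of samples that involve an edge of `F`. -/
noncomputable def samplesOf (F : Finset E) : RunState E → ℝ :=
  samplesIn fun d => d.1.1 ∈ F ∨ d.1.2 ∈ F

lemma samplesOf_le_samples (F : Finset E) : samplesOf F ≤ samples := by
  rintro ⟨h, x⟩
  simp only [samplesOf, samplesIn, samples]
  induction h with
  | nil => simp
  | cons o h ih =>
    rw [List.map_cons, List.sum_cons, List.length_cons, Nat.cast_succ]
    split_ifs <;> linarith

/-- A duel involves at most two edges. -/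
lemma sum_samplesOf_singleton_le (S : Finset E) :
    ∑ e ∈ S, samplesOf {e} ≤ (2 : ℝ) • samples := by
  rintro ⟨h, x⟩
  simp only [Finset.sum_apply, samplesOf, samplesIn, samples, Pi.smul_apply, smul_eq_mul,
    Finset.mem_singleton]
  induction h with
  | nil => simp
  | cons o h ih =>
    simp only [List.map_cons, List.sum_cons, List.length_cons, Nat.cast_succ]
    rw [Finset.sum_add_distrib]
    have h1 : ∑ e ∈ S, (if o.1.1.1 = e ∨ o.1.1.2 = e then (1 : ℝ) else 0) ≤
        ∑ e ∈ S, ((if o.1.1.1 = e then 1 else 0) + (if o.1.1.2 = e then 1 else 0)) := by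
      refine Finset.sum_le_sum fun e _ => ?_
      split_ifs <;> simp_all
    rw [Finset.sum_add_distrib, Finset.sum_ite_eq, Finset.sum_ite_eq] at h1
    have h2 : ∀ a : E, (if a ∈ S then (1 : ℝ) else 0) ≤ 1 := fun a => by split_ifs <;> norm_num
    linarith [h2 o.1.1.1, h2 o.1.1.2]

/-- Change of measure from `P` to its boost on `F`: the winner changes, while only duels touching
`F` change their law. -/
lemma log_le_mean_samplesOf (hE : ∃ M : Finset E, IsMatching M ∧ M.card = ℓ)
    {P : Preference E} {Mstar M : Finset E} (hstar : P.IsCondorcetWinner Mstar)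
    (hM : M ∈ decisionClass E) (hne : M ≠ Mstar)
    (hbeat : ∀ N ∈ P.beaters M, P.f M Mstar ≤ P.f M N ∧ Mstar \ M ⊆ N \ M)
    (hP : ∀ e e' : E, pos e = pos e' → 1 / 3 ≤ P.prob e e' ∧ P.prob e e' ≤ 2 / 3)
    {F : Finset E} (hF : F ⊆ M \ Mstar) {η : ℝ} (hη : 0 ≤ η) (hη' : η ≤ 1 / 4)
    (hwin : 1 / 2 - P.f M Mstar < η * F.card / ℓ) (hℓ : 0 < ℓ)
    {A : Algorithm E} {δ : ℝ} (hA : A.IsCorrect δ) (hδ : 0 < δ) (hδ' : δ < 0.1) {t : ℕ}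
    (ht : 1 - 3 / 2 * δ < A.mean P t (outputs Mstar)) :
    Real.log (1 / δ) ≤ 140 * η ^ 2 * A.mean P t (samplesOf F) := by
  classical
  have h : ∀ e e' : E, pos e = pos e' → |η| ≤ P.prob e e' := fun e e' hp => by
    rw [abs_of_nonneg hη]
    linarith [(hP e e' hp).1]
  have hQ := Preference.boost_isCondorcetWinner hE hstar hM hbeat hF hη h hwin hℓ
  have hw : ∀ d : Duel E, (P.boost F η h).win d = P.win d + η * (ind F d.1.1 - ind F d.1.2) :=
    fun d => congrArg (P.win d + ·) (if_pos d.2)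
  have hsm : ∀ d : Duel E, |η * (ind F d.1.1 - ind F d.1.2)| ≤ η := fun d => by
    rw [abs_mul, abs_of_nonneg hη]
    exact mul_le_of_le_one_right hη (ind_sub_mem F _ _)
  have hPd : ∀ d : Duel E, 1 / 3 ≤ P.win d ∧ P.win d ≤ 2 / 3 := fun d => hP _ _ d.2
  have hQd : ∀ d : Duel E, 1 / 12 ≤ (P.boost F η h).win d ∧ (P.boost F η h).win d ≤ 11 / 12 := by
    intro d
    have h1 := abs_le.1 (hsm d)
    rw [hw d]
    constructor <;> linarith [hPd d]
  have key := log_le_mean_samplesIn hA hδ hδ'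
    (P := P) (Q := P.boost F η h) (M := Mstar) (N := M) (K := 14 * η ^ 2)
    (fun d => ⟨by linarith [hPd d], by linarith [hPd d]⟩)
    (fun d => ⟨by linarith [hQd d], by linarith [hQd d]⟩) hQ hne.symm
    (fun d => d.1.1 ∈ F ∨ d.1.2 ∈ F) ?_ ?_ ht
  · refine key.trans_eq ?_
    unfold samplesOf
    ring
  · intro d _
    obtain ⟨h1, h2⟩ := hQd d
    -- The boosted probabilities lie in `[1/12, 11/12]`, so the χ²-divergence is at most `144/11 *
    -- η² ≤ 14 * η²`.
    have h3 : 11 / 144 ≤ (P.boost F η h).win d * (1 - (P.boost F η h).win d) := by nlinarith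
    have h4 : (P.win d - (P.boost F η h).win d) ^ 2 ≤ η ^ 2 := by
      rw [hw d, sub_add_cancel_left, neg_sq]
      exact sq_le_sq.2 ((hsm d).trans (le_abs_self η))
    rw [div_le_iff₀ (by linarith)]
    nlinarith [mul_le_mul_of_nonneg_left h3 (sq_nonneg η)]
  · intro d hd
    rw [not_or] at hd
    rw [hw d]
    simp [ind, hd.1, hd.2]

/-- Covers the edges with large gap: the whole of `M \ Mstar` is boosted, so a boost of order `γ`
per edge suffices however large the gap is. -/
lemma log_mul_sq_le_mean_samples (hE : ∃ M : Finset E, IsMatching M ∧ M.card = ℓ)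
    {P : Preference E} {Mstar M : Finset E} (hstar : P.IsCondorcetWinner Mstar)
    (hM : M ∈ decisionClass E) (hne : M ≠ Mstar)
    (hbeat : ∀ N ∈ P.beaters M, P.f M Mstar ≤ P.f M N ∧ Mstar \ M ⊆ N \ M)
    {γ : ℝ} (hγ : 0 < γ) (hγℓ : γ < 1 / (2 * (2 + (ℓ : ℝ))))
    (hP : ∀ e e' : E, pos e = pos e' → 1 / 2 - γ ≤ P.prob e e' ∧ P.prob e e' ≤ 1 / 2 + γ)
    (hℓ : 0 < ℓ) (hγ6 : γ < 1 / 6)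
    {A : Algorithm E} {δ : ℝ} (hA : A.IsCorrect δ) (hδ : 0 < δ) (hδ' : δ < 0.1) {t : ℕ}
    (ht : 1 - 3 / 2 * δ < A.mean P t (outputs Mstar)) :
    Real.log (1 / δ) * ℓ ^ 2 ≤ 315 / 4 * A.mean P t samples := by
  have hℓ' : (0 : ℝ) < ℓ := Nat.cast_pos.2 hℓ
  obtain ⟨m1, m2⟩ := (mem_decisionClass_iff hE).1 hM
  obtain ⟨s1, s2⟩ := (mem_decisionClass_iff hE).1 hstar.1
  have hF : (M \ Mstar).Nonempty := by
    rw [Finset.sdiff_nonempty]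
    exact fun h => hne (Finset.eq_of_subset_of_card_le h (s2.trans m2.symm).le)
  have hFc : (0 : ℝ) < (M \ Mstar).card := Nat.cast_pos.2 hF.card_pos
  have h1 := Preference.half_sub_le_f (fun e e' hp => (hP e e' hp).1) m2 s1 s2 hℓ
  have h2 : 0 < γ * (M \ Mstar).card / ℓ := by positivity
  -- The deficit of `M` is at most `γ * (M \ Mstar).card / ℓ`; the factor `3/2` makes the win strict
  -- and, as `γ < 1/6`, keeps `η ≤ 1/4`.
  have h3 := log_le_mean_samplesOf hE hstar hM hne hbeat
    (fun e e' hp => ⟨by linarith [hP e e' hp], by linarith [hP e e' hp]⟩)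
    (Finset.Subset.refl _) (η := 3 / 2 * γ) (by positivity) (by linarith)
    (by rw [mul_assoc, mul_div_assoc]; linarith) hℓ hA hδ hδ' ht
  have h4 := A.mean_mono P t (samplesOf_le_samples (M \ Mstar))
  have h5 : γ * ℓ ≤ 1 / 2 := by
    rw [lt_div_iff₀ (by positivity)] at hγℓ
    linarith
  have h6 : (γ * ℓ) ^ 2 ≤ (1 / 2) ^ 2 := pow_le_pow_left₀ (by positivity) h5 2
  have h7 : 0 ≤ A.mean P t samples := A.mean_nonneg P t fun s => Nat.cast_nonneg _
  calc Real.log (1 / δ) * ℓ ^ 2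
      ≤ 140 * (3 / 2 * γ) ^ 2 * A.mean P t (samplesOf (M \ Mstar)) * ℓ ^ 2 := by gcongr
    _ ≤ 140 * (3 / 2 * γ) ^ 2 * A.mean P t samples * ℓ ^ 2 := by gcongr
    _ = 315 * (γ * ℓ) ^ 2 * A.mean P t samples := by ring
    _ ≤ 315 * (1 / 2) ^ 2 * A.mean P t samples := by gcongr
    _ = _ := by ring

/-- A small gap is paid for by samples of `e`, a large one by a constant times `log (1/δ)`, charged
only to edges whose candidate occurs in `Mstar`. -/
lemma log_div_gap_le (hE : ∃ M : Finset E, IsMatching M ∧ M.card = ℓ)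
    {P : Preference E} {Mstar : Finset E} (hstar : P.IsCondorcetWinner Mstar)
    (hbeat : ∀ M ∈ decisionClass E, M ≠ Mstar → ∀ N ∈ P.beaters M,
      P.f M Mstar ≤ P.f M N ∧ Mstar \ M ⊆ N \ M)
    {γ : ℝ} (hγ6 : γ < 1 / 6)
    (hP : ∀ e e' : E, pos e = pos e' → 1 / 2 - γ ≤ P.prob e e' ∧ P.prob e e' ≤ 1 / 2 + γ)
    (hγ : 0 < γ) (hℓ : 0 < ℓ)
    {A : Algorithm E} {δ : ℝ} (hA : A.IsCorrect δ) (hδ : 0 < δ) (hδ' : δ < 0.1) {t : ℕ}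
    (ht : 1 - 3 / 2 * δ < A.mean P t (outputs Mstar)) {e : E} (he : e ∉ Mstar) :
    ENNReal.ofReal (Real.log (1 / δ)) / ((ℓ : ENNReal) ^ 2 * (P.gap Mstar e).toENNReal ^ 2) ≤
      ENNReal.ofReal (315 * A.mean P t (samplesOf {e}) +
        if cand e ∈ Mstar.image cand then 36 * Real.log (1 / δ) else 0) := by
  have hℓ' : (0 : ℝ) < ℓ := Nat.cast_pos.2 hℓ
  have hL : 0 ≤ Real.log (1 / δ) := by
    refine Real.log_nonneg ?_
    rw [le_div_iff₀ hδ]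
    norm_num at hδ'
    linarith
  have hN : 0 ≤ A.mean P t (samplesOf {e}) := A.mean_nonneg P t fun s => by
    refine List.sum_nonneg fun x hx => ?_
    obtain ⟨o, -, rfl⟩ := List.mem_map.1 hx
    split_ifs <;> simp
  obtain ⟨s1, s2⟩ := (mem_decisionClass_iff hE).1 hstar.1
  rcases P.gap_eq_top_or he with h | ⟨M, hM, heM, hgap, hmax⟩
  · rw [h, EReal.toENNReal_top, ENNReal.top_pow two_ne_zero, ENNReal.mul_top (by positivity),
      ENNReal.div_top]
    exact zero_le
  obtain ⟨m1, m2⟩ := (mem_decisionClass_iff hE).1 hM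
  have hne : M ≠ Mstar := fun h => he (h ▸ heM)
  set Δ : ℝ := 1 / 2 - P.f M Mstar with hΔ
  have hΔ0 : 0 < Δ := by
    have h1 := hstar.2 M hM hne
    have h2 := P.f_add_f_swap m2 s1 s2 hℓ
    linarith
  have hterm : ENNReal.ofReal (Real.log (1 / δ)) /
      ((ℓ : ENNReal) ^ 2 * (P.gap Mstar e).toENNReal ^ 2) =
      ENNReal.ofReal (Real.log (1 / δ) / (ℓ * Δ) ^ 2) := by
    rw [hgap, EReal.toENNReal_of_ne_top (EReal.coe_ne_top _), EReal.toReal_coe,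
      ENNReal.ofReal_div_of_pos (by positivity), ENNReal.ofReal_pow (by positivity),
      ENNReal.ofReal_mul hℓ'.le, ENNReal.ofReal_natCast, mul_pow]
  rw [hterm]
  refine ENNReal.ofReal_le_ofReal ?_
  -- The threshold makes `η = 3/2 * (ℓ * Δ)` at most `1/4`. The single edge `e` then adds `3/2 * Δ >
  -- Δ` to the score of `M`.
  rcases le_or_gt (ℓ * Δ) (1 / 6) with hs | hb
  · have h1 := log_le_mean_samplesOf hE hstar hM hne (hbeat M hM hne)
      (fun e e' hp => ⟨by linarith [hP e e' hp], by linarith [hP e e' hp]⟩)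
      (F := {e}) (by simpa using ⟨heM, he⟩) (η := 3 / 2 * (ℓ * Δ)) (by positivity) (by linarith)
      (by
        have : 3 / 2 * (ℓ * Δ) * (({e} : Finset E).card : ℝ) / ℓ = 3 / 2 * Δ := by
          rw [Finset.card_singleton, Nat.cast_one]
          field_simp
        rw [this]
        linarith) hℓ hA hδ hδ' ht
    have h2 : Real.log (1 / δ) / (ℓ * Δ) ^ 2 ≤ 315 * A.mean P t (samplesOf {e}) := by
      rw [div_le_iff₀ (by positivity)]
      refine h1.trans_eq ?_
      ring
    split_ifs <;> linarith
  -- Otherwise exchanging one edge of `Mstar` for `e` gives a matching that loses to `Mstar` by at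
  -- most `γ / ℓ`, so `ℓ * Δ ≤ γ < 1/6`.
  · have hc : cand e ∈ Mstar.image cand := by
      by_contra hc
      obtain ⟨N, n1, n2, heN, hNc⟩ := s1.exists_swap s2 hc
      have h1 := hmax N ((mem_decisionClass_iff hE).2 ⟨n1, n2⟩) heN
      have h2 := Preference.half_sub_le_f (fun e e' hp => (hP e e' hp).1) n2 s1 s2 hℓ
      have h3 : γ * ((N \ Mstar).card : ℝ) ≤ γ * 1 := by
        gcongr
        exact_mod_cast hNc
      have h4 : ℓ * Δ ≤ γ * (N \ Mstar).card := by
        have : Δ ≤ γ * (N \ Mstar).card / ℓ := by linarith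
        rw [le_div_iff₀ hℓ'] at this
        linarith
      linarith
    rw [if_pos hc]
    have h1 : Real.log (1 / δ) / (ℓ * Δ) ^ 2 ≤ Real.log (1 / δ) / (1 / 6) ^ 2 := by gcongr
    have h2 : Real.log (1 / δ) / (1 / 6) ^ 2 = 36 * Real.log (1 / δ) := by ring
    linarith

lemma sum_log_div_gap_le (hE : ∃ M : Finset E, IsMatching M ∧ M.card = ℓ)
    {P : Preference E} {Mstar : Finset E} (hstar : P.IsCondorcetWinner Mstar)
    (hbeat : ∀ M ∈ decisionClass E, M ≠ Mstar → ∀ N ∈ P.beaters M,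
      P.f M Mstar ≤ P.f M N ∧ Mstar \ M ⊆ N \ M)
    {γ : ℝ} (hγ : 0 < γ) (hγℓ : γ < 1 / (2 * (2 + (ℓ : ℝ))))
    (hP : ∀ e e' : E, pos e = pos e' → 1 / 2 - γ ≤ P.prob e e' ∧ P.prob e e' ≤ 1 / 2 + γ)
    (hℓ : 0 < ℓ)
    {A : Algorithm E} {δ : ℝ} (hA : A.IsCorrect δ) (hδ : 0 < δ) (hδ' : δ < 0.1) {t : ℕ}
    (ht : 1 - 3 / 2 * δ < A.mean P t (outputs Mstar)) :
    ∑ e ∈ Finset.univ \ Mstar, ENNReal.ofReal (Real.log (1 / δ)) /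
        ((ℓ : ENNReal) ^ 2 * (P.gap Mstar e).toENNReal ^ 2) ≤
      ENNReal.ofReal (3465 * A.mean P t samples) := by
  by_cases hother : ∃ M ∈ decisionClass E, M ≠ Mstar
  · obtain ⟨M, hM, hne⟩ := hother
    have hγ6 : γ < 1 / 6 := by
      refine hγℓ.trans_le (one_div_le_one_div_of_le (by norm_num) ?_)
      have : (1 : ℝ) ≤ ℓ := Nat.one_le_cast.2 hℓ
      linarith
    have hL : 0 ≤ Real.log (1 / δ) := by
      refine Real.log_nonneg ?_
      rw [le_div_iff₀ hδ]
      norm_num at hδ'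
      linarith
    obtain ⟨s1, -⟩ := (mem_decisionClass_iff hE).1 hstar.1
    have h1 := log_mul_sq_le_mean_samples hE hstar hM hne (hbeat M hM hne) hγ hγℓ hP hℓ hγ6
      hA hδ hδ' ht
    have h2 := A.mean_mono P t (sum_samplesOf_singleton_le (Finset.univ \ Mstar))
    rw [map_sum, map_smul, smul_eq_mul] at h2
    have h3 : ∑ e ∈ Finset.univ \ Mstar,
        (if cand e ∈ Mstar.image cand then 36 * Real.log (1 / δ) else 0) ≤
        36 * Real.log (1 / δ) * ℓ ^ 2 := by
      calc _ ≤ ∑ e : E, (if cand e ∈ Mstar.image cand then 36 * Real.log (1 / δ) else 0) := by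
            refine Finset.sum_le_sum_of_subset_of_nonneg (Finset.subset_univ _) fun e _ _ => ?_
            split_ifs <;> positivity
        _ = (Finset.univ.filter fun e : E => cand e ∈ Mstar.image cand).card *
              (36 * Real.log (1 / δ)) := by
            rw [← Finset.sum_filter, Finset.sum_const, nsmul_eq_mul]
        _ ≤ (ℓ * ℓ : ℕ) * (36 * Real.log (1 / δ)) := by
            gcongr
            exact s1.card_filter_cand_le
        _ = _ := by push_cast; ring
    have hnn : ∀ e ∈ Finset.univ \ Mstar, 0 ≤ 315 * A.mean P t (samplesOf {e}) +
        if cand e ∈ Mstar.image cand then 36 * Real.log (1 / δ) else 0 := by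
      intro e _
      have : 0 ≤ A.mean P t (samplesOf {e}) := A.mean_nonneg P t fun s => by
        refine List.sum_nonneg fun x hx => ?_
        obtain ⟨o, -, rfl⟩ := List.mem_map.1 hx
        split_ifs <;> simp
      split_ifs <;> positivity
    refine (Finset.sum_le_sum fun e he => log_div_gap_le hE hstar hbeat hγ6 hP hγ hℓ hA hδ hδ' ht
      (Finset.mem_sdiff.1 he).2).trans ?_
    rw [← ENNReal.ofReal_sum_of_nonneg hnn, Finset.sum_add_distrib, ← Finset.mul_sum]
    -- The constant is `3465 = 315 * 2 + 36 * (315 / 4)`: small gaps and large gaps.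
    refine ENNReal.ofReal_le_ofReal ?_
    linarith
  -- With `Mstar` the only maximum matching, every edge outside it has infinite gap and contributes
  -- `0`.
  · push Not at hother
    refine (Finset.sum_eq_zero fun e he => ?_).trans_le zero_le
    have he' := (Finset.mem_sdiff.1 he).2
    rcases P.gap_eq_top_or he' with h | ⟨M, hM, heM, -⟩
    · rw [h, EReal.toENNReal_top, ENNReal.top_pow two_ne_zero, ENNReal.mul_top (by positivity),
        ENNReal.div_top]
    · exact absurd (hother M hM ▸ heM) he'

end CPEDB

theorem theorem6 :
    ∃ c : ℝ, 0 < c ∧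
      ∀ (n ℓ : ℕ) (E : Finset (Fin n × Fin ℓ)),
        (∃ M : Finset E, CPEDB.IsMatching M ∧ M.card = ℓ) →
        ∀ (P : CPEDB.Preference E) (Mstar : Finset E), P.IsCondorcetWinner Mstar →
        (∀ M ∈ CPEDB.decisionClass E, M ≠ Mstar → ∀ N ∈ P.beaters M,
          P.f M Mstar ≤ P.f M N ∧ Mstar \ M ⊆ N \ M) →
        ∀ γ : ℝ, 0 < γ → γ < 1 / (2 * (2 + (ℓ : ℝ))) →
        (∀ e e' : E, CPEDB.pos e = CPEDB.pos e' →
          1 / 2 - γ ≤ P.prob e e' ∧ P.prob e e' ≤ 1 / 2 + γ) →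
        ∀ δ : ℝ, 0 < δ → δ < 0.1 →
        ∀ A : CPEDB.Algorithm E, A.IsCorrect δ →
          ENNReal.ofReal c *
              ∑ e ∈ Finset.univ \ Mstar,
                ENNReal.ofReal (Real.log (1 / δ)) /
                  ((ℓ : ENNReal) ^ 2 * (P.gap Mstar e).toENNReal ^ 2)
            ≤ A.expectedSamples P := by
  refine ⟨1 / 3465, by norm_num, fun n ℓ E hE P Mstar hstar hbeat γ hγ hγℓ hP δ hδ hδ' A hA => ?_⟩
  rcases Nat.eq_zero_or_pos ℓ with rfl | hℓ
  · rw [Finset.sum_eq_zero fun e _ => e.1.2.elim0, mul_zero]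
    exact zero_le
  -- Relaxing `δ` to `3/2 * δ` leaves room to stop at a finite horizon.
  obtain ⟨t, ht⟩ := CPEDB.exists_mean_outputs_gt A P Mstar (x := 1 - 3 / 2 * δ) (y := 1 - δ)
    (by linarith) (by norm_num at hδ'; linarith) (hA P Mstar hstar)
  refine le_trans ?_ (CPEDB.mean_samples_le A P t)
  refine (mul_le_mul_right (CPEDB.sum_log_div_gap_le hE hstar hbeat hγ hγℓ hP hℓ hA hδ hδ' ht)
    _).trans_eq ?_
  rw [← ENNReal.ofReal_mul (by norm_num)]
  congr 1
  ring
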